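/- **Setting.** Let $\Gamma$ be a finite extensive-form game with player set $N$, chance player $c$, and perfect recall (for chance as well); put $N_c=N\cup\{c\}$. Let $Z$ be the set of terminal histories and $u^i_z$ the payoff function of $i\in N$ on $Z$. For $i\in N_c$ let $I_i^j$, $j\in M_i$, be the information sets of $i$, with action sets $A(I_i^j)$, where actions at different information sets are regarded as different. Let $\varpi^i_h$ be the sequence of actions taken by $i$ along a history $h$, let $\varpi^i_I$ be the common sequence of $i$ leading to the information set $I$ of $i$, and let $W^i$ be the set of all sequences of $i$ (it consists of $\emptyset$ and the sequences $\varpi^i_{I}a$ with $a\in A(I)$). Chance chooses $a$ at its information set $I$ with probability $f_c(a|I)$. *Normal form.* $S^i$ is the set of reduced pure strategies $s^i$ of $i\in N_c$: $s^i$ chooses exactly one action at each information set of $i$ not precluded by $i$'s own choices under $s^i$, and none at the others. Write $s^i(a)=1$ if $s^i$ chooses $a$ and $s^i(a)=0$ otherwise, and $s^i(\varpi^i)=\prod_{a\in\varpi^i}s^i(a)$. For a pure strategy profile $s=(s^i)_{i\in N_c}$, $$u^i(s)=\sum_{h=\langle a_1,\dots,a_L\rangle\in Z}u^i_z(h)\prod_{q=0}^{L-1}s^{P(\langle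 a_1,\dots,a_q\rangle)}(a_{q+1}),$$ where $P(h)$ is the player moving after $h$. $\Xi$ is the set of mixed strategy profiles $\sigma=(\sigma^i)_{i\in N}$, $\sigma^i$ a probability distribution on $S^i$; chance plays $\sigma^c(s^c)=\prod_{a:\,s^c(a)=1}f_c(a)$. Put $$u^i(s^i,\sigma^{-i})=\sum_{s^{-i}}u^i(s^i,s^{-i})\prod_{k\in N_c\setminus\{i\}}\sigma^k(s^k).$$ For $\lambda\ge0$, $\sigma\in\Xi$ is a *logit QRE with parameter $\lambda$* if $\sigma^i(s^i)=e^{\lambda u^i(s^i,\sigma^{-i})}/\sum_{r\in S^i}e^{\lambda u^i(r,\sigma^{-i})}$ for all $i\in N$, $s^i\in S^i$. *Sequence form.* A realization plan of $i\in N$ is a function $\gamma^i:W^i\to\mathbb R$ with $\gamma^i(\emptyset)=1$ and, at every information set $I$ of $i$, $\sum_{a\in A(I)}\gamma^i(\varpi^i_Ia)=\gamma^i(\varpi^i_I)$ and $\gamma^i(\varpi^i_Ia)\ge0$ for $a\in A(I)$. $\Lambda^i$ is the set of these, $\Lambda=\prod_{i\in N}\Lambda^i$, and $\Lambda_{++}$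 is the set of strictly positive profiles in $\Lambda$; chance has the fixed plan $\gamma^c(\varpi^c)=\prod_{a\in\varpi^c}f_c(a)$. For a profile $\varpi=(\varpi^i)_{i\in N_c}$ of sequences let $g^i(\varpi)=u^i_z(h)$ if $\varpi=(\varpi^k_h)_{k\in N_c}$ for some $h\in Z$ and $g^i(\varpi)=0$ otherwise, and let $$g^i(\varpi^i,\gamma^{-i})=\sum_{\varpi^{-i}}g^i(\varpi^i,\varpi^{-i})\prod_{k\in N_c\setminus\{i\}}\gamma^k(\varpi^k).$$ $T$ is the set of pairs $(\sigma,\gamma)$ with $\sigma\in\Xi$ and $\gamma^i(\varpi^i)=\sum_{s^i\in S^i}s^i(\varpi^i)\sigma^i(s^i)$ for all $i\in N_c$, $\varpi^i\in W^i$. For $\gamma\in\Lambda_{++}$ let $\sigma(\gamma)$ be the mixed strategy profile $$\sigma^i(\gamma^i;s^i)=\prod_{j\in M_i,\;a\in A(I_i^j),\;s^i(a)=1}\frac{\gamma^i(\varpi^i_{I_i^j}a)}{\gamma^i(\varpi^i_{I_i^j})},\qquad i\in N,\ s^i\in S^i,$$ and, for given $\lambda\ge0$, let the logit response $\sigma_e(\gamma)$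 be $$\sigma_e^i(\gamma;s^i)=\frac{e^{\lambda u^i(s^i,\sigma^{-i}(\gamma^{-i}))}}{\sum_{r\in S^i}e^{\lambda u^i(r,\sigma^{-i}(\gamma^{-i}))}},\qquad i\in N,\ s^i\in S^i.$$ *Perturbed game.* For $t\in(0,1]$, $\gamma^*\in\Lambda$ is a Nash equilibrium of the entropy-perturbed game $\Gamma_s^e(t)$ if, for every $i\in N$, $\gamma^{*i}$ maximizes over $\gamma^i\in\Lambda^i$ $$(1-t)\sum_{j\in M_i}\sum_{a\in A(I_i^j)}\gamma^i(\varpi^i_{I_i^j}a)\,g^i(\varpi^i_{I_i^j}a,\gamma^{*-i})-t\sum_{j\in M_i}\sum_{a\in A(I_i^j)}\gamma^i(\varpi^i_{I_i^j}a)\bigl(\ln\gamma^i(\varpi^i_{I_i^j}a)-\ln\gamma^i(\varpi^i_{I_i^j})\bigr),$$ where a summand of the second sum with $\gamma^i(\varpi^i_{I_i^j}a)=0$ is read as $0$. **Theorem 1.** Let $t\in(0,1]$ and $\lambda=(1-t)/t$. If $\gamma^*$ is a Nash equilibrium of $\Gamma_s^e(t)$, then $\gamma^*\in\Lambda_{++}$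 (so that $\sigma(\gamma^*)$ and $\sigma_e(\gamma^*)$ are defined), $(\sigma_e(\gamma^*),\gamma^*)\in T$, and $\sigma_e(\gamma^*)$ is a logit QRE with parameter $\lambda$. -/

import Mathlib

open scoped Classical

noncomputable section

/-- The actions available after the history `h`: those `a` with `(h, a) ∈ H`. -/
def actionsAfter {α : Type*} (H : Finset (List α)) (h : List α) : Finset α :=
  (H.biUnion List.toFinset).filter (fun a => h ++ [a] ∈ H)

/-- The nonterminal histories of `H` after which `i` moves (`none` is the chance player). -/
def decisionNodes {N α : Type*} (H : Finset (List α)) (P : List α → Option N) (i : Option N) :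
    Finset (List α) :=
  H.filter (fun h => (actionsAfter H h).Nonempty ∧ P h = i)

/-- The actions available at the information set `I`. -/
def actionsAt {α : Type*} (H : Finset (List α)) (I : Finset (List α)) : Finset α :=
  I.biUnion (actionsAfter H)

/-- A finite extensive-form game with set of players `N`; the index `none : Option N` stands for
the chance player, so that `Option N` is the set of all players including chance.  The values of
`player` at terminal histories, of `chance` off the chance player's information sets, and of
`payoff` at nonterminal histories play no role.  Chance may have arbitrary information sets (in
particular singletons), and its move probabilities are the same after all histories of one
information set. -/
structure ExtensiveForm (N α : Type*) where
  /-- the finite set of histories -/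
  hist : Finset (List α)
  nil_mem : [] ∈ hist
  prefix_mem : ∀ (h : List α) (a : α), h ++ [a] ∈ hist → h ∈ hist
  /-- who moves after a nonterminal history -/
  player : List α → Option N
  /-- the information partition of each player -/
  info : ∀ i : Option N, Finpartition (decisionNodes hist player i)
  /-- the same actions are available at all histories of an information set -/
  actions_eq : ∀ i : Option N, ∀ I ∈ (info i).parts, ∀ h ∈ I, ∀ h' ∈ I,
    actionsAfter hist h = actionsAfter hist h'
  /-- `chance I a` is the probability that chance takes `a` at any history of `I` -/
  chance : Finset (List α) → α → ℝ
  chance_nonneg : ∀ I ∈ (info none).parts, ∀ a ∈ actionsAt hist I, 0 ≤ chance I a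
  chance_sum : ∀ I ∈ (info none).parts, ∑ a ∈ actionsAt hist I, chance I a = 1
  /-- payoffs at terminal histories -/
  payoff : N → List α → ℝ

/-- A move: an information set together with an action taken there. -/
abbrev Move (α : Type*) := Finset (List α) × α

/-- The pairs (history reached, action taken next) met when the actions of the second list are
taken after the history given by the first one. -/
def stepsFrom {α : Type*} : List α → List α → List (List α × α)
  | _, [] => []
  | p, a :: l => (p, a) :: stepsFrom (p ++ [a]) l

/-- For `h = ⟨a₁, …, a_L⟩`, the list of the pairs `(⟨a₁, …, a_q⟩, a_{q+1})`, `q = 0, …, L - 1`. -/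
def steps {α : Type*} (h : List α) : List (List α × α) := stepsFrom [] h

theorem stepsFrom_concat {α : Type*} (p l : List α) (a : α) :
    stepsFrom p (l ++ [a]) = stepsFrom p l ++ [(p ++ l, a)] := by
  induction l generalizing p with
  | nil => simp [stepsFrom]
  | cons b l ih => simp [stepsFrom, ih]

namespace ExtensiveForm

variable {N α : Type*} (G : ExtensiveForm N α)

/-- The terminal histories. -/
def terminal : Finset (List α) := G.hist.filter (fun h => actionsAfter G.hist h = ∅)

/-- The information sets of player `i`. -/
abbrev Info (i : Option N) := {I : Finset (List α) // I ∈ (G.info i).parts}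

/-- The actions available at an information set. -/
abbrev Act {i : Option N} (I : G.Info i) := {a : α // a ∈ actionsAt G.hist I.1}

/-- The information set (of the player who moves after `h`) that contains `h`. -/
def infoOf (h : List α) : Finset (List α) := (G.info (G.player h)).part h

/-- The record of player `i` along `h`: the information sets of `i` that `h` passes through, each
with the action taken there, in order.  Since an action is recorded together with its information
set, equal labels at different information sets cause no confusion, and the record is player `i`'s
sequence along `h`. -/
def record (i : Option N) (h : List α) : List (Move α) :=
  ((steps h).filter (fun x => G.player x.1 = i)).map (fun x => (G.infoOf x.1, x.2))

/-- Perfect recall: a player (chance included) has the same record at all histories of one of its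
information sets. -/
def PerfectRecall : Prop :=
  ∀ i : Option N, ∀ I ∈ (G.info i).parts, ∀ h ∈ I, ∀ h' ∈ I, G.record i h = G.record i h'

/-- The sequences of player `i`, including the empty one. -/
def seqs (i : Option N) : Finset (List (Move α)) := G.hist.image (G.record i)

/-- The type of sequences of player `i`. -/
abbrev Seq (i : Option N) := {w : List (Move α) // w ∈ G.seqs i}

/-- Some history of an information set. -/
def repr {i : Option N} (I : G.Info i) : List α :=
  ((G.info i).nonempty_of_mem_parts I.2).choose

theorem repr_mem {i : Option N} (I : G.Info i) : G.repr I ∈ I.1 :=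
  ((G.info i).nonempty_of_mem_parts I.2).choose_spec

theorem mem_nodes {i : Option N} (I : G.Info i) {h : List α} (hh : h ∈ I.1) :
    h ∈ decisionNodes G.hist G.player i :=
  (G.info i).le I.2 hh

/-- The empty sequence. -/
def nilSeq (i : Option N) : G.Seq i :=
  ⟨[], Finset.mem_image.2 ⟨[], G.nil_mem, by simp [record, steps, stepsFrom]⟩⟩

/-- The sequence of player `i` leading to the information set `I`. -/
def seqTo {i : Option N} (I : G.Info i) : G.Seq i :=
  ⟨G.record i (G.repr I), Finset.mem_image_of_mem _
    (Finset.mem_filter.1 (G.mem_nodes I (G.repr_mem I))).1⟩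

/-- All moves of player `i`. -/
def moves (i : Option N) : Finset (Move α) :=
  (G.info i).parts.biUnion (fun I => (actionsAt G.hist I).image (fun a => (I, a)))

/-- The information set `I` is not precluded by the moves in `s`: all moves of the sequence
leading to `I` belong to `s`. -/
def Reaches {i : Option N} (s : Finset (Move α)) (I : G.Info i) : Prop :=
  ∀ m ∈ (G.seqTo I).1, m ∈ s

/-- The (reduced) pure strategies of player `i`, as sets of moves: exactly one action is chosen at
every information set that player's own choices do not preclude, and none at the others. -/
def strats (i : Option N) : Finset (Finset (Move α)) :=
  (G.moves i).powerset.filter (fun s => ∀ I : G.Info i,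
    (G.Reaches s I → ∃! a : α, (I.1, a) ∈ s) ∧ (¬ G.Reaches s I → ∀ a : α, (I.1, a) ∉ s))

/-- The type of reduced pure strategies of player `i`. -/
abbrev Strat (i : Option N) := {s : Finset (Move α) // s ∈ G.strats i}

/-- `1` if the pure strategy `s` chooses the move `m`, and `0` otherwise. -/
def choice {i : Option N} (s : G.Strat i) (m : Move α) : ℝ := if m ∈ s.1 then 1 else 0

/-- The product of `choice s m` over the moves `m` of the sequence `w`. -/
def choiceSeq {i : Option N} (s : G.Strat i) (w : G.Seq i) : ℝ := (w.1.map (G.choice s)).prod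

/-- The payoff of player `i` at a profile of pure strategies (chance included). -/
def purePayoff (i : N) (s : ∀ j : Option N, G.Strat j) : ℝ :=
  ∑ h ∈ G.terminal, G.payoff i h *
    ((steps h).map (fun x => G.choice (s (G.player x.1)) (G.infoOf x.1, x.2))).prod

/-- Profiles of real weights on the pure strategies of the players other than chance. -/
abbrev StratProfile := ∀ i : N, G.Strat (some i) → ℝ

/-- The mixed strategy of chance: it draws its action at each information set independently. -/
def chanceMixed (s : G.Strat none) : ℝ := ∏ m ∈ s.1, G.chance m.1 m.2

/-- The profile `σ` completed by the mixed strategy of chance. -/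
def withChance (σ : G.StratProfile) : ∀ j : Option N, G.Strat j → ℝ
  | none => G.chanceMixed
  | some i => σ i

/-- The mixed strategy profiles. -/
def Mixed : Set G.StratProfile :=
  {σ | ∀ i : N, (∀ s, 0 ≤ σ i s) ∧ ∑ s, σ i s = 1}

/-- Player `i`'s expected payoff from the pure strategy `si` against the mixed strategies of all
other players, chance included. -/
def payoffAgainst [Fintype N] (i : N) (si : G.Strat (some i)) (σ : G.StratProfile) : ℝ :=
  ∑ s : (∀ j : Option N, G.Strat j) with s (some i) = si,
    G.purePayoff i s * ∏ j ∈ Finset.univ.erase (some i), G.withChance σ j (s j)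

/-- `σ` is a (normal-form) logit quantal response equilibrium with parameter `lam`. -/
def IsLogitQRE [Fintype N] (lam : ℝ) (σ : G.StratProfile) : Prop :=
  σ ∈ G.Mixed ∧ ∀ (i : N) (s : G.Strat (some i)),
    σ i s = Real.exp (lam * G.payoffAgainst i s σ) /
      ∑ s' : G.Strat (some i), Real.exp (lam * G.payoffAgainst i s' σ)

/-- Profiles of real-valued functions on the sequences of the players other than chance. -/
abbrev SeqProfile := ∀ i : N, G.Seq (some i) → ℝ

/-- The realization plan of chance. -/
def chancePlan (w : G.Seq none) : ℝ := (w.1.map (fun m => G.chance m.1 m.2)).prod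

/-- The profile `γ` completed by the realization plan of chance. -/
def planWithChance (γ : G.SeqProfile) : ∀ j : Option N, G.Seq j → ℝ
  | none => G.chancePlan
  | some i => γ i

/-- The payoff of player `i` at a profile of sequences: the payoff at the terminal history that
defines the profile, and `0` if there is none.  (At most one terminal history defines a given
profile, as two terminal histories part at a common information set, so the sum has at most one
term.) -/
def seqPayoff (i : N) (w : ∀ j : Option N, G.Seq j) : ℝ :=
  ∑ h ∈ G.terminal with ∀ j : Option N, (w j).1 = G.record j h, G.payoff i h

/-- Player `i`'s expected payoff from the sequence `wi` against the realization plans of all other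
players, chance included. -/
def seqPayoffAgainst [Fintype N] (i : N) (wi : G.Seq (some i)) (γ : G.SeqProfile) : ℝ :=
  ∑ w : (∀ j : Option N, G.Seq j) with w (some i) = wi,
    G.seqPayoff i w * ∏ j ∈ Finset.univ.erase (some i), G.planWithChance γ j (w j)

/-- The realization weights induced by a mixed strategy profile, for all players and chance. -/
def inducedPlan (σ : G.StratProfile) (j : Option N) (w : G.Seq j) : ℝ :=
  ∑ s : G.Strat j, G.choiceSeq s w * G.withChance σ j s

/-- The set `T` of the pairs `(σ, γ)` such that `σ` is a mixed strategy profile inducing `γ`. -/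
def T : Set (G.StratProfile × G.SeqProfile) :=
  {p | p.1 ∈ G.Mixed ∧ G.planWithChance p.2 = G.inducedPlan p.1}

end ExtensiveForm

/-- A finite extensive-form game with perfect recall. -/
structure RecallGame (N α : Type*) extends ExtensiveForm N α where
  perfectRecall : toExtensiveForm.PerfectRecall

namespace RecallGame

variable {N α : Type*} (G : RecallGame N α)

theorem concat_mem_seqs {i : Option N} (I : G.Info i) (a : G.Act I) :
    (G.seqTo I).1 ++ [(I.1, a.1)] ∈ G.seqs i := by
  obtain ⟨h, hI, ha⟩ := Finset.mem_biUnion.1 a.2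
  have hn := (Finset.mem_filter.1 (G.mem_nodes I hI)).2.2
  refine Finset.mem_image.2 ⟨h ++ [a.1], (Finset.mem_filter.1 ha).2, ?_⟩
  have hr : G.record i (G.repr I) = G.record i h :=
    G.perfectRecall i I.1 I.2 _ (G.repr_mem I) _ hI
  have hp : G.infoOf h = I.1 := by
    unfold ExtensiveForm.infoOf
    rw [hn]
    exact (G.info i).part_eq_of_mem I.2 hI
  simp only [ExtensiveForm.seqTo, hr]
  simp [ExtensiveForm.record, steps, stepsFrom_concat, hn, hp]

/-- The sequence leading to `I` extended by the action `a` at `I`. -/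
def seqExt {i : Option N} (I : G.Info i) (a : G.Act I) : G.Seq i :=
  ⟨(G.seqTo I).1 ++ [(I.1, a.1)], G.concat_mem_seqs I a⟩

/-- `x` is a realization plan of player `i`. -/
def IsPlan {i : Option N} (x : G.Seq i → ℝ) : Prop :=
  x (G.nilSeq i) = 1 ∧
  (∀ I : G.Info i, ∑ a : G.Act I, x (G.seqExt I a) - x (G.seqTo I) = 0) ∧
  ∀ (I : G.Info i) (a : G.Act I), 0 ≤ x (G.seqExt I a)

/-- The realization plan profiles. -/
def Plans : Set G.SeqProfile := {γ | ∀ i : N, G.IsPlan (γ i)}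

/-- The strictly positive realization plan profiles. -/
def PosPlans : Set G.SeqProfile :=
  {γ | γ ∈ G.Plans ∧ ∀ (i : N) (w : G.Seq (some i)), 0 < γ i w}

/-- The entropy-perturbed objective of player `i` for the plan `x` against `γ`.  As
`Real.log 0 = 0`, a term with `x (seqExt I a) = 0` vanishes: the usual convention `0 ln 0 = 0`. -/
def objective [Fintype N] (t : ℝ) (i : N) (γ : G.SeqProfile) (x : G.Seq (some i) → ℝ) : ℝ :=
  (1 - t) * ∑ I : G.Info (some i), ∑ a : G.Act I,
      x (G.seqExt I a) * G.seqPayoffAgainst i (G.seqExt I a) γ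
    - t * ∑ I : G.Info (some i), ∑ a : G.Act I,
      x (G.seqExt I a) * (Real.log (x (G.seqExt I a)) - Real.log (x (G.seqTo I)))

/-- `γ` is a Nash equilibrium of the entropy-perturbed sequence-form game with parameter `t`: each
player's plan maximizes that player's perturbed objective against `γ` over all its plans. -/
def IsPerturbedNash [Fintype N] (t : ℝ) (γ : G.SeqProfile) : Prop :=
  γ ∈ G.Plans ∧ ∀ i : N, IsMaxOn (G.objective t i γ) {x | G.IsPlan x} (γ i)

/-- The mixed strategy profile `σ(γ)` of a strictly positive realization plan profile `γ`: the
weight of `s` is the product, over the moves `(I, a)` chosen by `s`, of the ratios `γ(wa) / γ(w)`,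
where `w` is the sequence leading to `I`. -/
def mixedOf (γ : G.SeqProfile) : G.StratProfile :=
  fun i s => ∏ I : G.Info (some i), ∏ a : G.Act I with (I.1, a.1) ∈ s.1,
    γ i (G.seqExt I a) / γ i (G.seqTo I)

/-- The logit response `σ_e(γ)` with parameter `lam`. -/
def logitResponse [Fintype N] (lam : ℝ) (γ : G.SeqProfile) : G.StratProfile :=
  fun i s => Real.exp (lam * G.payoffAgainst i s (G.mixedOf γ)) /
    ∑ s' : G.Strat (some i), Real.exp (lam * G.payoffAgainst i s' (G.mixedOf γ))

end RecallGame

end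

namespace RecallGame

variable {N α : Type*} (G : RecallGame N α)

/-! Fix a player and write `g` for `lam` times the sequence payoffs against `γ`. Backward induction
gives each information set a log-sum-exp value `V`, hence softmax behaviour weights `b = exp (g +
values of the successor sets - V)`, positive and summing to one at each set. On a realization plan
`x` the values telescope, so `∑ x g = R + ∑ x log b` with `R` independent of `x`
(`exists_softmax_behavior`). The objective is therefore `t` times `R` minus the relative entropy of
`x` with respect to `b` (`objective_eq`). Gibbs' inequality makes the plan of `b` its only maximizer
(`eq_planOf_of_entropy_le`), which gives positivity.

A pure strategy `s` is itself a realization plan, so the same identity reads `exp (lam * payoff of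
s) = const * ∏ b` over the moves of `s`; this product is the weight of `s` in `σ(γ)`. These weights
sum to one, so normalizing shows that the logit response equals `σ(γ)`. By Kuhn's argument `σ(γ)`
induces `γ` (`sum_choiceSeq_mul_prod`). This yields membership in `T`, lets normal-form payoffs be
computed from sequence payoffs, and turns the logit response into a fixed point. -/

/-! ### Sequences under perfect recall -/

theorem record_nil (i : Option N) : G.record i [] = [] := by
  simp [ExtensiveForm.record, steps, stepsFrom]

theorem record_concat_self {i : Option N} {h : List α} (hp : G.player h = i) (a : α) :
    G.record i (h ++ [a]) = G.record i h ++ [(G.infoOf h, a)] := by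
  simp [ExtensiveForm.record, steps, stepsFrom_concat, hp]

theorem record_concat_of_ne {i : Option N} {h : List α} (hp : G.player h ≠ i) (a : α) :
    G.record i (h ++ [a]) = G.record i h := by
  simp [ExtensiveForm.record, steps, stepsFrom_concat, hp]

theorem mem_actionsAfter {H : Finset (List α)} {h : List α} {a : α} :
    a ∈ actionsAfter H h ↔ h ++ [a] ∈ H := by
  simp only [actionsAfter, Finset.mem_filter, Finset.mem_biUnion, List.mem_toFinset,
    and_iff_right_iff_imp]
  exact fun hh => ⟨_, hh, by simp⟩

theorem exists_info {i : Option N} {h : List α} {a : α} (hh : h ++ [a] ∈ G.hist)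
    (hp : G.player h = i) : ∃ (I : G.Info i) (c : G.Act I),
      G.infoOf h = I.1 ∧ c.1 = a ∧ G.record i h = (G.seqTo I).1 := by
  subst hp
  have hn : h ∈ decisionNodes G.hist G.player (G.player h) :=
    Finset.mem_filter.2 ⟨G.prefix_mem _ _ hh, ⟨a, mem_actionsAfter.2 hh⟩, rfl⟩
  have hmem : h ∈ G.infoOf h := (G.info (G.player h)).mem_part hn
  let I : G.Info (G.player h) := ⟨G.infoOf h, (G.info (G.player h)).part_mem.2 hn⟩
  exact ⟨I, ⟨a, Finset.mem_biUnion.2 ⟨h, hmem, mem_actionsAfter.2 hh⟩⟩, rfl, rfl,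
    G.perfectRecall _ I.1 I.2 _ hmem _ (G.repr_mem I)⟩

/-- Peel off the last action of a history: a foreign action leaves the record unchanged, and an own
action at `I` extends `seqTo I`, because perfect recall makes the record the same throughout `I`. -/
theorem seq_induction {i : Option N} {p : G.Seq i → Prop} (nil : p (G.nilSeq i))
    (ext : ∀ (I : G.Info i) (a : G.Act I), p (G.seqTo I) → p (G.seqExt I a)) (w : G.Seq i) :
    p w := by
  obtain ⟨w, hw⟩ := w
  obtain ⟨h, hh, rfl⟩ := Finset.mem_image.1 hw
  induction h using List.reverseRecOn with
  | nil =>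
    convert nil using 1
    exact Subtype.ext (G.record_nil i)
  | append_singleton h a ih =>
    have hh' := G.prefix_mem _ _ hh
    have ih' := ih hh' (Finset.mem_image_of_mem _ hh')
    by_cases hp : G.player h = i
    · obtain ⟨I, c, hI, rfl, hr⟩ := G.exists_info hh hp
      have e : (⟨_, Finset.mem_image_of_mem _ hh'⟩ : G.Seq i) = G.seqTo I := Subtype.ext hr
      rw [e] at ih'
      convert ext I c ih' using 1
      apply Subtype.ext
      simp only [seqExt]
      rw [G.record_concat_self hp, hr, hI]
    · convert ih' using 1
      exact Subtype.ext (G.record_concat_of_ne hp a)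

theorem seqExt_injective {i : Option N} :
    Function.Injective (fun p : (Σ I : G.Info i, G.Act I) => G.seqExt p.1 p.2) := by
  rintro ⟨⟨I, hI⟩, ⟨a, ha⟩⟩ ⟨⟨J, hJ⟩, ⟨b, hb⟩⟩ h
  have h' := congrArg Subtype.val h
  simp only [seqExt] at h'
  obtain ⟨-, h2⟩ := List.append_inj' h' rfl
  simp only [List.cons.injEq, Prod.mk.injEq, and_true] at h2
  obtain ⟨rfl, rfl⟩ := h2
  rfl

/-- A nonempty sequence is determined by its last move, since the rest is the sequence leading to
that information set. -/
theorem sum_seq {i : Option N} (f : G.Seq i → ℝ) :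
    ∑ w, f w = f (G.nilSeq i) + ∑ I : G.Info i, ∑ a : G.Act I, f (G.seqExt I a) := by
  let e : Option (Σ I : G.Info i, G.Act I) → G.Seq i :=
    fun o => o.elim (G.nilSeq i) (fun p => G.seqExt p.1 p.2)
  have he : Function.Bijective e := by
    constructor
    · rintro (_ | p) (_ | q) h
      · rfl
      · have := congrArg Subtype.val h
        simp [e, seqExt, ExtensiveForm.nilSeq] at this
      · have := congrArg Subtype.val h
        simp [e, seqExt, ExtensiveForm.nilSeq] at this
      · exact congrArg some (G.seqExt_injective h)
    · exact fun w => G.seq_induction (p := fun w => ∃ o, e o = w) ⟨none, rfl⟩ (fun I a _ => ⟨some ⟨I, a⟩, rfl⟩) w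
  rw [← Fintype.sum_bijective e he (fun o => f (e o)) f (fun _ => rfl), Fintype.sum_option,
    Fintype.sum_sigma]
  rfl

theorem mem_moves {i : Option N} {m : Move α} :
    m ∈ G.moves i ↔ ∃ (I : G.Info i) (a : G.Act I), m = (I.1, a.1) := by
  simp only [ExtensiveForm.moves, Finset.mem_biUnion, Finset.mem_image]
  constructor
  · rintro ⟨I, hI, a, ha, rfl⟩
    exact ⟨⟨I, hI⟩, ⟨a, ha⟩, rfl⟩
  · rintro ⟨I, a, rfl⟩
    exact ⟨I.1, I.2, a.1, a.2, rfl⟩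

theorem mem_moves_of_mem_seq {i : Option N} (w : G.Seq i) : ∀ m ∈ w.1, m ∈ G.moves i := by
  induction w using G.seq_induction with
  | nil => simp [ExtensiveForm.nilSeq]
  | ext I a ih =>
    intro m hm
    rcases List.mem_append.1 hm with h | h
    · exact ih m h
    · exact G.mem_moves.2 ⟨I, a, List.mem_singleton.1 h⟩

/-- This excludes meeting an information set twice along one sequence. -/
theorem length_seqTo_lt {i : Option N} (w : G.Seq i) (I : G.Info i) (c : α)
    (h : (I.1, c) ∈ w.1) : (G.seqTo I).1.length < w.1.length := by
  induction w using G.seq_induction with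
  | nil => simp [ExtensiveForm.nilSeq] at h
  | ext J b ih =>
    have hl : (G.seqExt J b).1.length = (G.seqTo J).1.length + 1 := by simp [seqExt]
    rcases List.mem_append.1 h with h | h
    · have := ih h
      omega
    · have : I = J := Subtype.ext (congrArg Prod.fst (List.mem_singleton.1 h))
      subst this
      omega

theorem notMem_seqTo {i : Option N} (I : G.Info i) (c : α) : (I.1, c) ∉ (G.seqTo I).1 :=
  fun h => lt_irrefl _ (G.length_seqTo_lt _ I c h)

theorem nodup_seq {i : Option N} (w : G.Seq i) : w.1.Nodup := by
  induction w using G.seq_induction with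
  | nil => simp [ExtensiveForm.nilSeq]
  | ext I a ih =>
    simp only [seqExt]
    refine List.nodup_append.2 ⟨ih, by simp, ?_⟩
    rintro m hm _ hm' rfl
    rw [List.mem_singleton.1 hm'] at hm
    exact G.notMem_seqTo I _ hm

theorem action_unique_of_mem_seq {i : Option N} (w : G.Seq i) (I : G.Info i) (a a' : α)
    (h : (I.1, a) ∈ w.1) (h' : (I.1, a') ∈ w.1) : a = a' := by
  induction w using G.seq_induction with
  | nil => simp [ExtensiveForm.nilSeq] at h
  | ext J b ih =>
    rcases List.mem_append.1 h with h | h <;> rcases List.mem_append.1 h' with h' | h'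
    · exact ih h h'
    · have e : I = J := Subtype.ext (congrArg Prod.fst (List.mem_singleton.1 h'))
      subst e
      exact (G.notMem_seqTo _ _ h).elim
    · have e : I = J := Subtype.ext (congrArg Prod.fst (List.mem_singleton.1 h))
      subst e
      exact (G.notMem_seqTo _ _ h').elim
    · rw [List.mem_singleton] at h h'
      exact (congrArg Prod.snd h).trans (congrArg Prod.snd h').symm

theorem act_nonempty {i : Option N} (I : G.Info i) : Nonempty (G.Act I) := by
  obtain ⟨a, ha⟩ := (Finset.mem_filter.1 (G.mem_nodes I (G.repr_mem I))).2.1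
  exact ⟨⟨a, Finset.mem_biUnion.2 ⟨_, G.repr_mem I, ha⟩⟩⟩

theorem prod_moves {i : Option N} {m : Finset (Move α)} (hm : m ⊆ G.moves i) (b : Move α → ℝ) :
    ∏ I : G.Info i, ∏ a : G.Act I with (I.1, a.1) ∈ m, b (I.1, a.1) = ∏ p ∈ m, b p := by
  rw [Finset.prod_sigma']
  refine Finset.prod_bij (fun p _ => (p.1.1, p.2.1)) ?_ ?_ ?_ ?_
  · intro p hp
    simpa using hp
  · rintro ⟨⟨I, hI⟩, ⟨a, ha⟩⟩ _ ⟨⟨J, hJ⟩, ⟨b, hb⟩⟩ _ h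
    obtain ⟨rfl, rfl⟩ := Prod.mk.inj h
    rfl
  · intro p hp
    obtain ⟨I, a, rfl⟩ := G.mem_moves.1 (hm hp)
    exact ⟨⟨I, a⟩, by simpa using hp, rfl⟩
  · intros
    rfl

/-! ### Reduced and unreduced strategies; Kuhn's theorem -/

/-- The moves of an unreduced pure strategy. -/
noncomputable def fullMoves {i : Option N} (f : ∀ I : G.Info i, G.Act I) : Finset (Move α) :=
  Finset.univ.image (fun I => (I.1, (f I).1))

theorem mem_fullMoves {i : Option N} (f : ∀ I : G.Info i, G.Act I) (I : G.Info i) (c : α) :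
    (I.1, c) ∈ G.fullMoves f ↔ (f I).1 = c := by
  simp only [fullMoves, Finset.mem_image, Finset.mem_univ, true_and, Prod.mk.injEq]
  constructor
  · rintro ⟨J, h, rfl⟩
    rw [Subtype.ext h]
  · rintro rfl
    exact ⟨I, rfl, rfl⟩

/-- Cylinder probability under a product measure: the `f` containing `m` form a box, an information
set met by `m` contributes the weight of its prescribed action, and every other set contributes a
full sum, which is 1. -/
theorem sum_fullMoves {i : Option N} (b : Move α → ℝ)
    (hb : ∀ I : G.Info i, ∑ a : G.Act I, b (I.1, a.1) = 1) {m : Finset (Move α)}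
    (hm : m ⊆ G.moves i)
    (hu : ∀ (I : G.Info i) (a a' : α), (I.1, a) ∈ m → (I.1, a') ∈ m → a = a') :
    ∑ f : (∀ I : G.Info i, G.Act I) with m ⊆ G.fullMoves f, ∏ I, b (I.1, (f I).1)
      = ∏ p ∈ m, b p := by
  have hset : (Finset.univ.filter fun f : (∀ I : G.Info i, G.Act I) => m ⊆ G.fullMoves f)
      = Fintype.piFinset (fun I => Finset.univ.filter
          (fun a : G.Act I => ∀ c, (I.1, c) ∈ m → a.1 = c)) := by
    ext f
    simp only [Finset.mem_filter, Finset.mem_univ, true_and, Fintype.mem_piFinset]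
    constructor
    · exact fun h I c hc => (G.mem_fullMoves f I c).1 (h hc)
    · intro h p hp
      obtain ⟨I, a, rfl⟩ := G.mem_moves.1 (hm hp)
      exact (G.mem_fullMoves f I _).2 (h I _ hp)
  rw [hset, ← Finset.prod_univ_sum (κ := fun I : G.Info i => G.Act I)
    (f := fun I a => b (I.1, a.1)), ← G.prod_moves hm]
  refine Finset.prod_congr rfl fun I _ => ?_
  by_cases h : ∃ a : G.Act I, (I.1, a.1) ∈ m
  · obtain ⟨a, ha⟩ := h
    have e1 : (Finset.univ.filter (fun a : G.Act I => ∀ c, (I.1, c) ∈ m → a.1 = c)) = {a} := by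
      ext x
      simp only [Finset.mem_filter, Finset.mem_univ, true_and, Finset.mem_singleton]
      constructor
      · exact fun hx => Subtype.ext (hx _ ha)
      · rintro rfl c hc
        exact hu I _ _ ha hc
    have e2 : (Finset.univ.filter (fun x : G.Act I => (I.1, x.1) ∈ m)) = {a} := by
      ext x
      simp only [Finset.mem_filter, Finset.mem_univ, true_and, Finset.mem_singleton]
      constructor
      · exact fun hx => Subtype.ext (hu I _ _ hx ha)
      · rintro rfl
        exact ha
    rw [e1, e2, Finset.sum_singleton, Finset.prod_singleton]
  · have e1 : (Finset.univ.filter (fun a : G.Act I => ∀ c, (I.1, c) ∈ m → a.1 = c))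
        = Finset.univ := by
      refine Finset.filter_true_of_mem fun x _ c hc => (h ?_).elim
      obtain ⟨J, a, hJ⟩ := G.mem_moves.1 (hm hc)
      obtain ⟨h1, rfl⟩ := Prod.mk.inj hJ
      obtain rfl : I = J := Subtype.ext h1
      exact ⟨a, hc⟩
    have e2 : (Finset.univ.filter (fun x : G.Act I => (I.1, x.1) ∈ m)) = ∅ :=
      Finset.filter_false_of_mem fun x _ hx => h ⟨x, hx⟩
    rw [e1, e2, Finset.prod_empty, hb]

theorem mem_strats {i : Option N} {s : Finset (Move α)} : s ∈ G.strats i ↔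
    s ⊆ G.moves i ∧ ∀ I : G.Info i,
      (G.Reaches s I → ∃! a : α, (I.1, a) ∈ s) ∧ (¬ G.Reaches s I → ∀ a : α, (I.1, a) ∉ s) := by
  simp [ExtensiveForm.strats]

theorem reaches_of_mem {i : Option N} (s : G.Strat i) (I : G.Info i) {a : α}
    (h : (I.1, a) ∈ s.1) : G.Reaches s.1 I := by
  by_contra hn
  exact ((G.mem_strats.1 s.2).2 I).2 hn a h

theorem action_unique_of_mem_strat {i : Option N} (s : G.Strat i) (I : G.Info i) (a a' : α)
    (h : (I.1, a) ∈ s.1) (h' : (I.1, a') ∈ s.1) : a = a' :=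
  (((G.mem_strats.1 s.2).2 I).1 (G.reaches_of_mem s I h)).unique h h'

/-- The moves of the reduced strategy that belongs to an unreduced pure strategy. -/
noncomputable def reducedMoves {i : Option N} (f : ∀ I : G.Info i, G.Act I) :
    Finset (Move α) :=
  (Finset.univ.filter (fun I : G.Info i => G.Reaches (G.fullMoves f) I)).image
    (fun I => (I.1, (f I).1))

theorem mem_reducedMoves {i : Option N} (f : ∀ I : G.Info i, G.Act I) (I : G.Info i) (c : α) :
    (I.1, c) ∈ G.reducedMoves f ↔ G.Reaches (G.fullMoves f) I ∧ (f I).1 = c := by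
  simp only [reducedMoves, Finset.mem_image, Finset.mem_filter, Finset.mem_univ, true_and,
    Prod.mk.injEq]
  constructor
  · rintro ⟨J, hJ, h, rfl⟩
    obtain rfl := Subtype.ext h
    exact ⟨hJ, rfl⟩
  · rintro ⟨h, rfl⟩
    exact ⟨I, h, rfl, rfl⟩

theorem reducedMoves_subset {i : Option N} (f : ∀ I : G.Info i, G.Act I) :
    G.reducedMoves f ⊆ G.fullMoves f :=
  Finset.image_subset_image (Finset.filter_subset _ _)

/-- Dropping precluded choices loses no sequence played by `f`: each of its moves is made at a set
reached by the preceding ones. -/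
theorem seq_subset_reducedMoves {i : Option N} (f : ∀ I : G.Info i, G.Act I) (w : G.Seq i) :
    (∀ m ∈ w.1, m ∈ G.reducedMoves f) ↔ ∀ m ∈ w.1, m ∈ G.fullMoves f := by
  refine ⟨fun h m hm => G.reducedMoves_subset f (h m hm), ?_⟩
  induction w using G.seq_induction with
  | nil => simp [ExtensiveForm.nilSeq]
  | ext I a ih =>
    intro h m hm
    have hI : ∀ m ∈ (G.seqTo I).1, m ∈ G.fullMoves f :=
      fun m hm => h m (List.mem_append_left _ hm)
    rcases List.mem_append.1 hm with h' | h'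
    · exact ih hI m h'
    · rw [List.mem_singleton.1 h']
      have := h m hm
      rw [List.mem_singleton.1 h'] at this
      exact (G.mem_reducedMoves f I _).2 ⟨hI, (G.mem_fullMoves f I _).1 this⟩

theorem reaches_reducedMoves {i : Option N} (f : ∀ I : G.Info i, G.Act I) (I : G.Info i) :
    G.Reaches (G.reducedMoves f) I ↔ G.Reaches (G.fullMoves f) I :=
  G.seq_subset_reducedMoves f (G.seqTo I)

theorem reducedMoves_mem_strats {i : Option N} (f : ∀ I : G.Info i, G.Act I) :
    G.reducedMoves f ∈ G.strats i := by
  refine G.mem_strats.2 ⟨?_, fun I => ⟨fun h => ?_, fun h a ha => h ?_⟩⟩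
  · intro m hm
    obtain ⟨I, -, rfl⟩ := Finset.mem_image.1 hm
    exact G.mem_moves.2 ⟨I, f I, rfl⟩
  · rw [G.reaches_reducedMoves] at h
    exact ⟨(f I).1, (G.mem_reducedMoves f I _).2 ⟨h, rfl⟩,
      fun a ha => ((G.mem_reducedMoves f I _).1 ha).2.symm⟩
  · rw [G.reaches_reducedMoves]
    exact ((G.mem_reducedMoves f I _).1 ha).1

/-- The reduced strategy that belongs to an unreduced pure strategy. -/
noncomputable def reduced {i : Option N} (f : ∀ I : G.Info i, G.Act I) : G.Strat i :=
  ⟨G.reducedMoves f, G.reducedMoves_mem_strats f⟩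

theorem seq_subset_strat {i : Option N} (f : ∀ I : G.Info i, G.Act I) (s : G.Strat i)
    (hs : s.1 ⊆ G.fullMoves f) (w : G.Seq i) (hw : ∀ m ∈ w.1, m ∈ G.fullMoves f) :
    ∀ m ∈ w.1, m ∈ s.1 := by
  induction w using G.seq_induction with
  | nil => simp [ExtensiveForm.nilSeq]
  | ext I a ih =>
    have ih' := ih fun m hm => hw m (List.mem_append_left _ hm)
    have ha : (I.1, a.1) ∈ G.fullMoves f := hw _ (by simp [seqExt])
    intro m hm
    rcases List.mem_append.1 hm with h | h
    · exact ih' m h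
    · obtain ⟨c, hc, -⟩ := ((G.mem_strats.1 s.2).2 I).1 ih'
      have h1 := (G.mem_fullMoves f I _).1 (hs hc)
      have h2 := (G.mem_fullMoves f I _).1 ha
      rw [List.mem_singleton.1 h, ← h2, h1]
      exact hc

/-- Identifies the fibre of the reduction over `s` as the cylinder of `s`, whose mass
`sum_fullMoves` computes. A reduced strategy contained in `f` must choose at every set it reaches,
and there it can only agree with `f`. -/
theorem reduced_eq_iff {i : Option N} (f : ∀ I : G.Info i, G.Act I) (s : G.Strat i) :
    G.reduced f = s ↔ s.1 ⊆ G.fullMoves f := by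
  constructor
  · rintro rfl
    exact G.reducedMoves_subset f
  · intro h
    apply Subtype.ext
    ext m
    constructor
    · intro hm
      obtain ⟨I, hI, rfl⟩ := Finset.mem_image.1 hm
      have hI' : G.Reaches s.1 I :=
        G.seq_subset_strat f s h (G.seqTo I) (Finset.mem_filter.1 hI).2
      obtain ⟨c, hc, -⟩ := ((G.mem_strats.1 s.2).2 I).1 hI'
      have h1 := (G.mem_fullMoves f I _).1 (h hc)
      simpa only [h1] using hc
    · intro hm
      obtain ⟨I, a, rfl⟩ := G.mem_moves.1 ((G.mem_strats.1 s.2).1 hm)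
      exact (G.mem_reducedMoves f I _).2
        ⟨fun m' hm' => h (G.reaches_of_mem s I hm m' hm'), (G.mem_fullMoves f I _).1 (h hm)⟩

theorem choiceSeq_eq {i : Option N} (s : G.Strat i) (w : G.Seq i) :
    G.choiceSeq s w = if ∀ m ∈ w.1, m ∈ s.1 then 1 else 0 := by
  have key : ∀ l : List (Move α),
      (l.map (G.choice s)).prod = if ∀ m ∈ l, m ∈ s.1 then 1 else 0 := by
    intro l
    induction l with
    | nil => simp
    | cons m l ih =>
      rw [List.map_cons, List.prod_cons, ih]
      by_cases h : m ∈ s.1 <;> simp [ExtensiveForm.choice, h]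
  exact key w.1

/-- Behaviour weights and the mixed strategy that they define induce the same realization
weights. -/
theorem sum_choiceSeq_mul_prod {i : Option N} (b : Move α → ℝ)
    (hb : ∀ I : G.Info i, ∑ a : G.Act I, b (I.1, a.1) = 1) (w : G.Seq i) :
    ∑ s : G.Strat i, G.choiceSeq s w * ∏ m ∈ s.1, b m = (w.1.map b).prod := by
  have h1 : ∀ s : G.Strat i, G.choiceSeq s w * ∏ m ∈ s.1, b m
      = ∑ f : (∀ I : G.Info i, G.Act I) with G.reduced f = s,
        (if ∀ m ∈ w.1, m ∈ G.fullMoves f then ∏ I, b (I.1, (f I).1) else 0) := by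
    intro s
    rw [← G.sum_fullMoves b hb (G.mem_strats.1 s.2).1 (G.action_unique_of_mem_strat s),
      Finset.mul_sum]
    refine Finset.sum_congr (Finset.filter_congr fun f _ => (G.reduced_eq_iff f s).symm) ?_
    intro f hf
    obtain rfl := (Finset.mem_filter.1 hf).2
    rw [G.choiceSeq_eq]
    simp only [reduced, G.seq_subset_reducedMoves]
    split_ifs <;> simp
  -- The fibres partition the unreduced strategies, so what remains is the mass of the cylinder of
  -- `w`.
  rw [Finset.sum_congr rfl fun s _ => h1 s, Finset.sum_fiberwise, ← Finset.sum_filter]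
  have h2 := G.sum_fullMoves (i := i) b hb (m := w.1.toFinset)
    (fun m hm => G.mem_moves_of_mem_seq w m (List.mem_toFinset.1 hm))
    (fun I a a' h h' => G.action_unique_of_mem_seq w I a a' (List.mem_toFinset.1 h)
      (List.mem_toFinset.1 h'))
  rw [List.prod_toFinset b (G.nodup_seq w)] at h2
  rw [← h2]
  refine Finset.sum_congr (Finset.filter_congr fun f _ => ?_) fun _ _ => rfl
  simp [Finset.subset_iff]

theorem choiceSeq_nilSeq {i : Option N} (s : G.Strat i) : G.choiceSeq s (G.nilSeq i) = 1 := by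
  simp [ExtensiveForm.choiceSeq, ExtensiveForm.nilSeq]

/-- The last move decides, since a reduced strategy chooses only at sets that it reaches. -/
theorem choiceSeq_seqExt {i : Option N} (s : G.Strat i) (I : G.Info i) (a : G.Act I) :
    G.choiceSeq s (G.seqExt I a) = if (I.1, a.1) ∈ s.1 then 1 else 0 := by
  rw [G.choiceSeq_eq]
  refine if_congr ⟨fun h => h _ (by simp [seqExt]), fun h m hm => ?_⟩ rfl rfl
  rcases List.mem_append.1 hm with h' | h'
  · exact G.reaches_of_mem s I h m h'
  · rw [List.mem_singleton.1 h']
    exact h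

theorem sum_choiceSeq_seqExt {i : Option N} (s : G.Strat i) (I : G.Info i) :
    ∑ a : G.Act I, G.choiceSeq s (G.seqExt I a) = G.choiceSeq s (G.seqTo I) := by
  simp only [G.choiceSeq_seqExt]
  by_cases h : ∀ m ∈ (G.seqTo I).1, m ∈ s.1
  · obtain ⟨c, hc, hu⟩ := ((G.mem_strats.1 s.2).2 I).1 h
    obtain ⟨J, a, hJ⟩ := G.mem_moves.1 ((G.mem_strats.1 s.2).1 hc)
    obtain ⟨h1, rfl⟩ := Prod.mk.inj hJ
    obtain rfl : I = J := Subtype.ext h1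
    rw [G.choiceSeq_eq, if_pos h, Finset.sum_eq_single a, if_pos hc]
    · exact fun x _ hx => if_neg fun hx' => hx (Subtype.ext (hu _ hx'))
    · simp
  · rw [G.choiceSeq_eq, if_neg h]
    exact Finset.sum_eq_zero fun a _ => if_neg (((G.mem_strats.1 s.2).2 I).2 h _)

/-- Every pure strategy is a realization plan. -/
theorem isPlan_choiceSeq {i : Option N} (s : G.Strat i) : G.IsPlan (G.choiceSeq s) := by
  refine ⟨G.choiceSeq_nilSeq s, fun I => sub_eq_zero.2 (G.sum_choiceSeq_seqExt s I),
    fun I a => ?_⟩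
  rw [G.choiceSeq_seqExt]
  split_ifs <;> norm_num

/-! ### Normal-form and sequence-form payoffs -/

theorem sum_prod_fixed {ι : Type*} [Fintype ι] [DecidableEq ι] {S : ι → Type*}
    [∀ j, Fintype (S j)] [∀ j, DecidableEq (S j)] (i : ι)
    (x : S i) (A : ∀ j, S j → ℝ) :
    ∑ s : (∀ j, S j) with s i = x, ∏ j, A j (s j)
      = A i x * ∏ j ∈ Finset.univ.erase i, ∑ y, A j y := by
  have hset : (Finset.univ.filter fun s : (∀ j, S j) => s i = x)
      = Fintype.piFinset (fun j => Finset.univ.filter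
          (fun y : S j => ∀ h : j = i, h ▸ y = x)) := by
    ext s
    simp only [Finset.mem_filter, Finset.mem_univ, true_and, Fintype.mem_piFinset]
    constructor
    · rintro h j rfl
      exact h
    · exact fun h => h i rfl
  rw [hset, ← Finset.prod_univ_sum, ← Finset.mul_prod_erase _ _ (Finset.mem_univ i)]
  congr 1
  · have : (Finset.univ.filter (fun y : S i => ∀ h : i = i, h ▸ y = x)) = {x} := by
      ext y
      simp
    rw [this, Finset.sum_singleton]
  · refine Finset.prod_congr rfl fun j hj => ?_
    rw [Finset.filter_true_of_mem]
    exact fun y _ h => ((Finset.mem_erase.1 hj).1 h).elim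

theorem prod_steps_choice [Fintype N] (s : ∀ j : Option N, G.Strat j) (h : List α) :
    ((steps h).map (fun x => G.choice (s (G.player x.1)) (G.infoOf x.1, x.2))).prod
      = ∏ j, ((G.record j h).map (G.choice (s j))).prod := by
  induction h using List.reverseRecOn with
  | nil => simp [steps, stepsFrom, record_nil]
  | append_singleton h a ih =>
    have e : steps (h ++ [a]) = steps h ++ [(h, a)] := by
      simp [steps, stepsFrom_concat]
    rw [e, List.map_append, List.prod_append, ih,
      ← Finset.mul_prod_erase _ _ (Finset.mem_univ (G.player h)),
      ← Finset.mul_prod_erase _ _ (Finset.mem_univ (G.player h)),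
      G.record_concat_self rfl, List.map_append, List.prod_append]
    have : ∏ j ∈ Finset.univ.erase (G.player h), ((G.record j (h ++ [a])).map
        (G.choice (s j))).prod
        = ∏ j ∈ Finset.univ.erase (G.player h), ((G.record j h).map (G.choice (s j))).prod :=
      Finset.prod_congr rfl fun j hj => by
        rw [G.record_concat_of_ne (Finset.mem_erase.1 hj).1.symm]
    rw [this]
    simp only [List.map_cons, List.map_nil, List.prod_cons, List.prod_nil]
    ring

/-- The sequence of player `j` along a terminal history. -/
noncomputable def terminalSeq (j : Option N) (h : {h // h ∈ G.terminal}) : G.Seq j :=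
  ⟨G.record j h.1, Finset.mem_image_of_mem _ (Finset.mem_filter.1 h.2).1⟩

theorem payoffAgainst_eq [Fintype N] (i : N) (si : G.Strat (some i)) (σ : G.StratProfile) :
    G.payoffAgainst i si σ = ∑ h : {h // h ∈ G.terminal}, G.payoff i h.1 *
      (G.choiceSeq si (G.terminalSeq (some i) h) *
        ∏ j ∈ Finset.univ.erase (some i), G.inducedPlan σ j (G.terminalSeq j h)) := by
  unfold ExtensiveForm.payoffAgainst ExtensiveForm.purePayoff
  simp only [Finset.sum_mul]
  rw [Finset.sum_comm, ← Finset.sum_coe_sort]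
  refine Finset.sum_congr rfl fun h _ => ?_
  -- The factor of player `i` carries no mixed weight, because that strategy is held fixed.
  have key := sum_prod_fixed (S := fun j => G.Strat j) (some i) si
    (fun j s => if j = some i then G.choiceSeq s (G.terminalSeq j h) else
      G.choiceSeq s (G.terminalSeq j h) * G.withChance σ j s)
  have e : ∏ j ∈ Finset.univ.erase (some i), G.inducedPlan σ j (G.terminalSeq j h)
      = ∏ j ∈ Finset.univ.erase (some i), ∑ y, (if j = some i then
        G.choiceSeq y (G.terminalSeq j h) else
        G.choiceSeq y (G.terminalSeq j h) * G.withChance σ j y) :=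
    Finset.prod_congr rfl fun j hj => by
      simp only [if_neg (Finset.mem_erase.1 hj).1, ExtensiveForm.inducedPlan]
  rw [if_pos rfl, ← e] at key
  rw [← key, Finset.mul_sum]
  refine Finset.sum_congr rfl fun s _ => ?_
  rw [G.prod_steps_choice, mul_assoc]
  congr 1
  rw [← Finset.mul_prod_erase _ _ (Finset.mem_univ (some i)),
    ← Finset.mul_prod_erase _ _ (Finset.mem_univ (some i)), if_pos rfl, mul_assoc,
    ← Finset.prod_mul_distrib]
  congr 1
  refine Finset.prod_congr rfl fun j hj => ?_
  rw [if_neg (Finset.mem_erase.1 hj).1]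
  rfl

theorem seqPayoff_eq (i : N) (w : ∀ j : Option N, G.Seq j) :
    G.seqPayoff i w = ∑ h : {h // h ∈ G.terminal},
      if (fun j => G.terminalSeq j h) = w then G.payoff i h.1 else 0 := by
  rw [ExtensiveForm.seqPayoff, Finset.sum_filter, ← Finset.sum_coe_sort]
  refine Finset.sum_congr rfl fun h _ => if_congr ⟨fun hw => ?_, ?_⟩ rfl rfl
  · exact funext fun j => Subtype.ext (hw j).symm
  · rintro rfl j
    rfl

theorem seqPayoffAgainst_eq [Fintype N] (i : N) (wi : G.Seq (some i)) (γ : G.SeqProfile) :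
    G.seqPayoffAgainst i wi γ = ∑ h : {h // h ∈ G.terminal},
      if G.terminalSeq (some i) h = wi then G.payoff i h.1 *
        ∏ j ∈ Finset.univ.erase (some i), G.planWithChance γ j (G.terminalSeq j h) else 0 := by
  simp only [ExtensiveForm.seqPayoffAgainst, G.seqPayoff_eq, Finset.sum_mul]
  rw [Finset.sum_comm]
  refine Finset.sum_congr rfl fun h _ => ?_
  rw [Finset.sum_filter, Finset.sum_eq_single (fun j => G.terminalSeq j h)]
  · simp
  · intro w _ hw
    rw [if_neg hw.symm, zero_mul, ite_self]
  · simp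

/-- Opponents enter the payoff only through the realization weights they induce. The sum includes
the empty sequence, which the perturbed objective omits. -/
theorem payoffAgainst_eq_sum_seq [Fintype N] (i : N) (si : G.Strat (some i))
    (σ : G.StratProfile) (γ : G.SeqProfile)
    (h : ∀ j : Option N, G.planWithChance γ j = G.inducedPlan σ j) :
    G.payoffAgainst i si σ = ∑ w, G.choiceSeq si w * G.seqPayoffAgainst i w γ := by
  simp only [G.payoffAgainst_eq, G.seqPayoffAgainst_eq, Finset.mul_sum]
  rw [Finset.sum_comm]
  refine Finset.sum_congr rfl fun z _ => ?_
  rw [Finset.sum_eq_single (G.terminalSeq (some i) z), if_pos rfl]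
  · simp only [h]
    ring
  · intro w _ hw
    rw [if_neg hw.symm, mul_zero]
  · simp

theorem plan_nonneg {i : Option N} {x : G.Seq i → ℝ} (hx : G.IsPlan x) (w : G.Seq i) :
    0 ≤ x w := by
  induction w using G.seq_induction with
  | nil => rw [hx.1]; exact zero_le_one
  | ext I a _ => exact hx.2.2 I a

theorem plan_sum {i : Option N} {x : G.Seq i → ℝ} (hx : G.IsPlan x) (I : G.Info i) :
    ∑ a : G.Act I, x (G.seqExt I a) = x (G.seqTo I) :=
  sub_eq_zero.1 (hx.2.1 I)

/-! ### Softmax values and behaviour -/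

/-- Backward induction for log-sum-exp values on the information sets. -/
theorem exists_softmax_value {i : Option N} (g : G.Seq i → ℝ) :
    ∃ V : G.Info i → ℝ, ∀ I, ∑ a : G.Act I, Real.exp (g (G.seqExt I a)
      + ∑ J : G.Info i with G.seqTo J = G.seqExt I a, V J - V I) = 1 := by
  -- Sets with longer leading sequences come first, so the recursion starts from the last
  -- information sets.
  let r : G.Info i → G.Info i → Prop :=
    fun J I => (G.seqTo I).1.length < (G.seqTo J).1.length
  have : IsTrans (G.Info i) r := ⟨fun _ _ _ h h' => lt_trans h' h⟩
  have : Std.Irrefl r := ⟨fun _ h => lt_irrefl _ h⟩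
  have wf : WellFounded r := Finite.wellFounded_of_trans_of_irrefl r
  have hlt : ∀ (I : G.Info i) (a : G.Act I) (J : G.Info i), G.seqTo J = G.seqExt I a → r J I := by
    intro I a J h
    change (G.seqTo I).1.length < (G.seqTo J).1.length
    rw [h]
    simp [seqExt]
  let V : G.Info i → ℝ := wf.fix fun I F => Real.log (∑ a : G.Act I,
    Real.exp (g (G.seqExt I a) + ∑ J : {J : G.Info i // G.seqTo J = G.seqExt I a},
      F J.1 (hlt I a J.1 J.2)))
  refine ⟨V, fun I => ?_⟩
  have hV : V I = Real.log (∑ a : G.Act I, Real.exp (g (G.seqExt I a)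
      + ∑ J : G.Info i with G.seqTo J = G.seqExt I a, V J)) := by
    have e : ∀ a : G.Act I, ∑ J : G.Info i with G.seqTo J = G.seqExt I a, V J
        = ∑ J : {J : G.Info i // G.seqTo J = G.seqExt I a}, V J.1 := fun a =>
      Finset.sum_subtype _ (by simp) _
    simp only [e]
    exact wf.fix_eq _ I
  have := G.act_nonempty I
  have hpos : 0 < ∑ a : G.Act I, Real.exp (g (G.seqExt I a)
      + ∑ J : G.Info i with G.seqTo J = G.seqExt I a, V J) :=
    Finset.sum_pos (fun _ _ => Real.exp_pos _) Finset.univ_nonempty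
  simp only [Real.exp_sub]
  rw [← Finset.sum_div, hV, Real.exp_log hpos, div_self hpos.ne']

/-- Group the information sets by the sequence leading to them; that sequence is empty or ends in a
unique move. -/
theorem plan_telescope {i : Option N} {x : G.Seq i → ℝ} (hx : G.IsPlan x) (V : G.Info i → ℝ) :
    ∑ I : G.Info i, x (G.seqTo I) * V I = ∑ J : G.Info i with G.seqTo J = G.nilSeq i, V J
      + ∑ I : G.Info i, ∑ a : G.Act I, x (G.seqExt I a)
        * ∑ J : G.Info i with G.seqTo J = G.seqExt I a, V J := by
  have h := G.sum_seq (fun w => x w * ∑ J : G.Info i with G.seqTo J = w, V J)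
  simp only [hx.1, one_mul] at h
  rw [← h, ← Finset.sum_fiberwise _ (fun I => G.seqTo I)]
  refine Finset.sum_congr rfl fun w _ => ?_
  rw [Finset.mul_sum]
  exact Finset.sum_congr rfl fun J hJ => by rw [(Finset.mem_filter.1 hJ).2]

/-- Strategies and sequences are collections of bare moves, so weights are needed on all of `Move
α`; the values elsewhere are immaterial. -/
theorem exists_move_extension {i : Option N} (L : ∀ I : G.Info i, G.Act I → ℝ) :
    ∃ b : Move α → ℝ, ∀ (I : G.Info i) (a : G.Act I), b (I.1, a.1) = L I a := by
  have hinj : Function.Injective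
      (fun p : (Σ I : G.Info i, G.Act I) => ((p.1.1, p.2.1) : Move α)) := by
    rintro ⟨⟨I, hI⟩, ⟨a, ha⟩⟩ ⟨⟨J, hJ⟩, ⟨b, hb⟩⟩ h
    obtain ⟨rfl, rfl⟩ := Prod.mk.inj h
    rfl
  exact ⟨Function.extend (fun p : (Σ I : G.Info i, G.Act I) => ((p.1.1, p.2.1) : Move α))
    (fun p => L p.1 p.2) 0, fun I a => hinj.extend_apply _ _ ⟨I, a⟩⟩

/-- The behaviour strategy that solves the entropy-regularized problem with payoffs `g`. -/
theorem exists_softmax_behavior {i : Option N} (g : G.Seq i → ℝ) :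
    ∃ (b : Move α → ℝ) (R : ℝ), (∀ (I : G.Info i) (a : G.Act I), 0 < b (I.1, a.1)) ∧
      (∀ I : G.Info i, ∑ a : G.Act I, b (I.1, a.1) = 1) ∧
      ∀ x : G.Seq i → ℝ, G.IsPlan x →
        ∑ I : G.Info i, ∑ a : G.Act I, x (G.seqExt I a) * g (G.seqExt I a)
          = R + ∑ I : G.Info i, ∑ a : G.Act I, x (G.seqExt I a) * Real.log (b (I.1, a.1)) := by
  obtain ⟨V, hV⟩ := G.exists_softmax_value g
  obtain ⟨b, hb⟩ := G.exists_move_extension (i := i) fun I a => Real.exp (g (G.seqExt I a)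
      + ∑ J : G.Info i with G.seqTo J = G.seqExt I a, V J - V I)
  refine ⟨b, ∑ J : G.Info i with G.seqTo J = G.nilSeq i, V J, fun I a => ?_, fun I => ?_,
    fun x hx => ?_⟩
  · rw [hb]
    exact Real.exp_pos _
  · simp only [hb]
    exact hV I
  · have h1 := G.plan_telescope hx V
    -- The term `- V I` in `log b`, weighted over the actions at `I`, sums to `x (seqTo I) * V I`;
    -- telescoping then leaves only the values at the initial sets.
    have h2 : ∑ I : G.Info i, x (G.seqTo I) * V I
        = ∑ I : G.Info i, ∑ a : G.Act I, x (G.seqExt I a) * V I :=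
      Finset.sum_congr rfl fun I _ => by rw [← Finset.sum_mul, G.plan_sum hx]
    simp only [hb, Real.log_exp, mul_sub, mul_add, Finset.sum_sub_distrib, Finset.sum_add_distrib]
    linarith

/-! ### Gibbs' inequality for realization plans -/

/-- The realization plan of a behaviour strategy. -/
noncomputable def planOf (i : Option N) (b : Move α → ℝ) (w : G.Seq i) : ℝ := (w.1.map b).prod

theorem planOf_seqExt {i : Option N} (b : Move α → ℝ) (I : G.Info i) (a : G.Act I) :
    G.planOf i b (G.seqExt I a) = G.planOf i b (G.seqTo I) * b (I.1, a.1) := by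
  simp [planOf, seqExt]

theorem planOf_pos {i : Option N} {b : Move α → ℝ}
    (hb : ∀ (I : G.Info i) (a : G.Act I), 0 < b (I.1, a.1)) (w : G.Seq i) :
    0 < G.planOf i b w := by
  induction w using G.seq_induction with
  | nil => simp [planOf, ExtensiveForm.nilSeq]
  | ext I a ih =>
    rw [G.planOf_seqExt]
    exact mul_pos ih (hb I a)

theorem isPlan_planOf {i : Option N} {b : Move α → ℝ}
    (hb : ∀ (I : G.Info i) (a : G.Act I), 0 < b (I.1, a.1))
    (hb1 : ∀ I : G.Info i, ∑ a : G.Act I, b (I.1, a.1) = 1) : G.IsPlan (G.planOf i b) := by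
  refine ⟨by simp [planOf, ExtensiveForm.nilSeq], fun I => ?_,
    fun I a => (G.planOf_pos hb _).le⟩
  simp only [G.planOf_seqExt]
  rw [← Finset.mul_sum, hb1, mul_one, sub_self]

/-- The hypothesis is a product rather than a ratio, so that it makes sense at sets where the plan
vanishes. -/
theorem eq_planOf {i : Option N} {x : G.Seq i → ℝ} (hx : G.IsPlan x) {b : Move α → ℝ}
    (h : ∀ (I : G.Info i) (a : G.Act I),
      x (G.seqExt I a) = x (G.seqTo I) * b (I.1, a.1)) : x = G.planOf i b := by
  funext w
  induction w using G.seq_induction with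
  | nil => simp [planOf, ExtensiveForm.nilSeq, ← hx.1]
  | ext I a ih => rw [h, G.planOf_seqExt, ih]

/-- This is `log z ≤ z - 1` at `z = X * c / y`, strict for `z ≠ 1`. The case `y = 0` relies on the
zero factor, and `y ≤ X` keeps `X` positive otherwise. -/
theorem sub_le_mul_log_div {X y c : ℝ} (hX : 0 ≤ X) (hy : 0 ≤ y) (hyX : y ≤ X) (hc : 0 < c) :
    y - X * c ≤ y * (Real.log y - Real.log X - Real.log c) ∧
      (y * (Real.log y - Real.log X - Real.log c) = y - X * c → y = X * c) := by
  rcases hy.eq_or_lt with rfl | hy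
  · constructor
    · have := mul_nonneg hX hc.le
      simpa using this
    · intro h
      linarith
  · have hX : 0 < X := hy.trans_le hyX
    have hp : 0 < X * c / y := by positivity
    have e : Real.log y - Real.log X - Real.log c = -Real.log (X * c / y) := by
      rw [Real.log_div (by positivity) hy.ne', Real.log_mul hX.ne' hc.ne']
      ring
    have e2 : y - X * c = y * (1 - X * c / y) := by
      field_simp
    rw [e, e2]
    refine ⟨mul_le_mul_of_nonneg_left ?_ hy.le, fun h => ?_⟩
    · linarith [Real.log_le_sub_one_of_pos hp]
    · by_contra hne
      have h1 : X * c / y ≠ 1 := fun h1 => hne (by rw [div_eq_one_iff_eq hy.ne'] at h1; linarith)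
      have h2 := Real.log_lt_sub_one_of_pos hp h1
      have h3 := mul_left_cancel₀ hy.ne' h
      linarith

/-- Gibbs' inequality for realization plans, with its case of equality. -/
theorem eq_planOf_of_entropy_le {i : Option N} {x : G.Seq i → ℝ} (hx : G.IsPlan x)
    {b : Move α → ℝ} (hb : ∀ (I : G.Info i) (a : G.Act I), 0 < b (I.1, a.1))
    (hb1 : ∀ I : G.Info i, ∑ a : G.Act I, b (I.1, a.1) = 1)
    (h : ∑ I : G.Info i, ∑ a : G.Act I, x (G.seqExt I a) * (Real.log (x (G.seqExt I a))
      - Real.log (x (G.seqTo I)) - Real.log (b (I.1, a.1))) ≤ 0) : x = G.planOf i b := by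
  have hle : ∀ (I : G.Info i) (a : G.Act I), x (G.seqExt I a) ≤ x (G.seqTo I) := fun I a => by
    rw [← G.plan_sum hx I]
    exact Finset.single_le_sum (f := fun a => x (G.seqExt I a)) (fun a _ => hx.2.2 I a)
      (Finset.mem_univ a)
  have key := fun (I : G.Info i) (a : G.Act I) =>
    sub_le_mul_log_div (G.plan_nonneg hx (G.seqTo I)) (hx.2.2 I a) (hle I a) (hb I a)
  refine G.eq_planOf hx fun I a => (key I a).2 ?_
  -- The linear lower bounds cancel at each information set. A nonpositive total therefore forces
  -- equality in every term.
  have h0 : ∀ I : G.Info i,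
      ∑ a : G.Act I, (x (G.seqExt I a) - x (G.seqTo I) * b (I.1, a.1)) = 0 := fun I => by
    rw [Finset.sum_sub_distrib, G.plan_sum hx, ← Finset.mul_sum, hb1, mul_one, sub_self]
  have hD : ∀ I ∈ (Finset.univ : Finset (G.Info i)), 0 ≤ ∑ a : G.Act I, x (G.seqExt I a) *
      (Real.log (x (G.seqExt I a)) - Real.log (x (G.seqTo I)) - Real.log (b (I.1, a.1))) :=
    fun I _ => by
      rw [← h0 I]
      exact Finset.sum_le_sum fun a _ => (key I a).1
  have hI := (Finset.sum_eq_zero_iff_of_nonneg hD).1 (le_antisymm h (Finset.sum_nonneg hD)) I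
    (Finset.mem_univ I)
  rw [← h0 I] at hI
  exact ((Finset.sum_eq_sum_iff_of_le fun a _ => (key I a).1).1 hI.symm a (Finset.mem_univ a)).symm

/-! ### The maximizer and the logit response -/

theorem objective_eq [Fintype N] {t lam : ℝ} (ht : 0 < t) (hlam : lam = (1 - t) / t) (i : N)
    (γ : G.SeqProfile) {b : Move α → ℝ} {R : ℝ}
    (hR : ∀ x : G.Seq (some i) → ℝ, G.IsPlan x →
        ∑ I : G.Info (some i), ∑ a : G.Act I,
          x (G.seqExt I a) * (lam * G.seqPayoffAgainst i (G.seqExt I a) γ)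
          = R + ∑ I : G.Info (some i), ∑ a : G.Act I,
            x (G.seqExt I a) * Real.log (b (I.1, a.1)))
    {x : G.Seq (some i) → ℝ} (hx : G.IsPlan x) :
    G.objective t i γ x = t * (R - ∑ I : G.Info (some i), ∑ a : G.Act I, x (G.seqExt I a) *
      (Real.log (x (G.seqExt I a)) - Real.log (x (G.seqTo I)) - Real.log (b (I.1, a.1)))) := by
  have h := hR x hx
  have e : 1 - t = t * lam := by
    rw [hlam]
    field_simp
  simp only [mul_left_comm _ lam, ← Finset.mul_sum] at h
  -- Restricting the pattern to `(_ - _) - c` splits off only the `log b` term and keeps the entropy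
  -- sum in the form it has in `objective`.
  have e2 : ∀ u v c : ℝ, u * (v - c) = u * v - u * c := mul_sub
  simp only [e2 _ (_ - _) _, Finset.sum_sub_distrib]
  rw [objective, e, mul_assoc, h]
  simp only [mul_sub, Finset.sum_sub_distrib]
  ring

/-- One vector `b` plays both roles: its plan is the maximizer, and its products over pure
strategies are proportional to the logit weights. -/
theorem exists_behavior_of_isMaxOn [Fintype N] {t lam : ℝ} (ht : 0 < t)
    (hlam : lam = (1 - t) / t) (i : N) (γ : G.SeqProfile) {x : G.Seq (some i) → ℝ}
    (hx : G.IsPlan x) (hmax : IsMaxOn (G.objective t i γ) {x | G.IsPlan x} x) :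
    ∃ (b : Move α → ℝ) (R : ℝ), (∀ (I : G.Info (some i)) (a : G.Act I), 0 < b (I.1, a.1)) ∧
      (∀ I : G.Info (some i), ∑ a : G.Act I, b (I.1, a.1) = 1) ∧ x = G.planOf (some i) b ∧
      ∀ s : G.Strat (some i), Real.exp (lam * ∑ w, G.choiceSeq s w * G.seqPayoffAgainst i w γ)
        = Real.exp R * ∏ m ∈ s.1, b m := by
  obtain ⟨b, R, hb, hb1, hR⟩ :=
    G.exists_softmax_behavior (fun w => lam * G.seqPayoffAgainst i w γ)
  -- The payoff of the empty sequence is added here: it is absent from the objective but is part of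
  -- every pure strategy's payoff.
  refine ⟨b, R + lam * G.seqPayoffAgainst i (G.nilSeq (some i)) γ, hb, hb1,
    G.eq_planOf_of_entropy_le hx hb hb1 ?_, fun s => ?_⟩
  -- Compare `x` with the plan of `b`, whose relative entropy is zero.
  · have hy := G.isPlan_planOf hb hb1
    have hle : G.objective t i γ (G.planOf (some i) b) ≤ G.objective t i γ x := hmax hy
    rw [G.objective_eq ht hlam i γ hR hx, G.objective_eq ht hlam i γ hR hy] at hle
    have hle' := le_of_mul_le_mul_left hle ht
    have h0 : ∑ I : G.Info (some i), ∑ a : G.Act I, G.planOf (some i) b (G.seqExt I a) *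
        (Real.log (G.planOf (some i) b (G.seqExt I a))
          - Real.log (G.planOf (some i) b (G.seqTo I)) - Real.log (b (I.1, a.1))) = 0 := by
      refine Finset.sum_eq_zero fun I _ => Finset.sum_eq_zero fun a _ => ?_
      rw [G.planOf_seqExt, Real.log_mul (G.planOf_pos hb _).ne' (hb I a).ne']
      ring
    linarith
  -- The identity `hR` has no entropy term in `x`, so it can be evaluated at the 0-1 plan of `s`.
  · have h := hR _ (G.isPlan_choiceSeq s)
    have h2 : ∑ I : G.Info (some i), ∑ a : G.Act I,
        G.choiceSeq s (G.seqExt I a) * Real.log (b (I.1, a.1)) = Real.log (∏ m ∈ s.1, b m) := by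
      rw [← G.prod_moves (G.mem_strats.1 s.2).1, Real.log_prod fun I _ =>
        (Finset.prod_pos fun a _ => hb I a).ne']
      refine Finset.sum_congr rfl fun I _ => ?_
      rw [Real.log_prod fun a _ => (hb I a).ne', Finset.sum_filter]
      refine Finset.sum_congr rfl fun a _ => ?_
      rw [G.choiceSeq_seqExt]
      split_ifs <;> simp
    have hpos : 0 < ∏ m ∈ s.1, b m := Finset.prod_pos fun m hm => by
      obtain ⟨I, a, rfl⟩ := G.mem_moves.1 ((G.mem_strats.1 s.2).1 hm)
      exact hb I a
    rw [h2] at h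
    simp only [mul_left_comm _ lam, ← Finset.mul_sum] at h
    rw [G.sum_seq, G.choiceSeq_nilSeq, one_mul, mul_add, h, ← add_assoc, Real.exp_add,
      Real.exp_log hpos]
    congr 2
    ring

theorem mixedOf_eq (γ : G.SeqProfile) (i : N) {b : Move α → ℝ}
    (hb : ∀ (I : G.Info (some i)) (a : G.Act I), 0 < b (I.1, a.1))
    (hγ : γ i = G.planOf (some i) b) (s : G.Strat (some i)) :
    G.mixedOf γ i s = ∏ m ∈ s.1, b m := by
  rw [← G.prod_moves (G.mem_strats.1 s.2).1]
  refine Finset.prod_congr rfl fun I _ => Finset.prod_congr rfl fun a _ => ?_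
  rw [hγ, G.planOf_seqExt, mul_div_cancel_left₀ _ (G.planOf_pos hb _).ne']

theorem sum_chance (I : G.Info none) : ∑ a : G.Act I, G.chance I.1 a.1 = 1 := by
  rw [← G.chance_sum I.1 I.2]
  exact Finset.sum_coe_sort (actionsAt G.hist I.1) (fun a => G.chance I.1 a)

end RecallGame

theorem theorem1 {N α : Type*} [Fintype N] (G : RecallGame N α) (t lam : ℝ)
    (ht : t ∈ Set.Ioc (0 : ℝ) 1) (hlam : lam = (1 - t) / t)
    (γ : G.SeqProfile) (hγ : G.IsPerturbedNash t γ) :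
    γ ∈ G.PosPlans ∧ (G.logitResponse lam γ, γ) ∈ G.T ∧
      G.IsLogitQRE lam (G.logitResponse lam γ) := by
  choose b R hb hb1 hx hexp using fun i =>
    G.exists_behavior_of_isMaxOn ht.1 hlam i γ (hγ.1 i) (hγ.2 i)
  have hmix : ∀ i s, G.mixedOf γ i s = ∏ m ∈ s.1, b i m := fun i s =>
    G.mixedOf_eq γ i (hb i) (hx i) s
  have hplan : ∀ j : Option N, G.planWithChance γ j = G.inducedPlan (G.mixedOf γ) j := by
    rintro (_ | i) <;> funext w
    -- Chance probabilities may vanish; only their summing to one is used.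
    · exact (G.sum_choiceSeq_mul_prod (fun m => G.chance m.1 m.2) G.sum_chance w).symm
    · change γ i w = ∑ s, G.choiceSeq s w * G.mixedOf γ i s
      simp only [hmix, G.sum_choiceSeq_mul_prod (b i) (hb1 i) w]
      rw [hx i]
      rfl
  have hsum : ∀ i, ∑ s, G.mixedOf γ i s = 1 := fun i => by
    have h := G.sum_choiceSeq_mul_prod (b i) (hb1 i) (G.nilSeq (some i))
    simp only [G.choiceSeq_nilSeq, one_mul] at h
    simp only [hmix, h]
    simp [ExtensiveForm.nilSeq]
  have hpay : ∀ i s, Real.exp (lam * G.payoffAgainst i s (G.mixedOf γ))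
      = Real.exp (R i) * G.mixedOf γ i s := fun i s => by
    rw [G.payoffAgainst_eq_sum_seq i s _ γ hplan, hexp, hmix]
  -- The constant `exp (R i)` cancels, as the weights of `σ(γ)` sum to one.
  have hresp : G.logitResponse lam γ = G.mixedOf γ := by
    funext i s
    simp only [RecallGame.logitResponse, hpay]
    rw [← Finset.mul_sum, hsum, mul_one, mul_div_cancel_left₀ _ (Real.exp_pos _).ne']
  have hmem : G.mixedOf γ ∈ G.Mixed := fun i => ⟨fun s => by
    rw [← hresp]
    exact div_nonneg (Real.exp_pos _).le (Finset.sum_nonneg fun _ _ => (Real.exp_pos _).le),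
    hsum i⟩
  refine ⟨⟨hγ.1, fun i w => ?_⟩, ?_, ?_⟩
  · rw [hx i]
    exact G.planOf_pos (hb i) w
  · rw [hresp]
    exact ⟨hmem, funext hplan⟩
  · rw [hresp]
    refine ⟨hmem, fun i s => ?_⟩
    -- Rewriting the left side alone leaves the definition of the logit response against `σ(γ)`,
    -- which is the equilibrium condition.
    conv_lhs => rw [← hresp]
    rfl
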